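/- Let $n\ge 1$, let $0,\alpha(1),\dots,\alpha(n)\in(2\mathbb N)^n$ be affinely independent, and let $\Delta=\operatorname{conv}\{0,\alpha(1),\dots,\alpha(n)\}\subset\mathbb R^n$ be the even simplex that they span. Let $I\subseteq \operatorname{Int}(\Delta)\cap\mathbb N^n$ be a nonempty finite set, let $b_0,\dots,b_n>0$ and $a_y>0$ $(y\in I)$ be real numbers, and put $$f \;=\; b_0+\sum_{j=1}^n b_j\,\mathbf x^{\alpha(j)}-\sum_{y\in I}a_y\,\mathbf x^{y}\in\mathbb R[x_1,\dots,x_n],$$ so that the Newton polytope of $f$ is $\Delta$. Let $d\in\mathbb N$ with $\deg f\le 2d$. Let $P_{n,2d}$ be the set of polynomials of degree at most $2d$ that are nonnegative on $\mathbb R^n$, and let $\Sigma_{n,2d}$ be the set of those that are finite sums of squares of polynomials of degree at most $d$. For $y\in\operatorname{Int}(\Delta)\cap\mathbb N^n$ let $P_\Delta^y$ be the set of circuit polynomials $\sum_{j=0}^n \beta_j\mathbf x^{\alpha(j)}+c\,\mathbf x^y$, where $\alpha(0)=0$, all $\beta_j>0$ and $c\ne 0$. (1) $f\in P_{n,2d}$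 if and only if $f=\sum_{y\in I}E_y$ for some polynomials $E_y\in P_\Delta^{y}\cap P_{n,2d}$ $(y\in I)$; in particular $E_y$ is supported on $\{0,\alpha(1),\dots,\alpha(n),y\}$. Put $\hat\Delta=\{0,\alpha(1),\dots,\alpha(n)\}$. A set $L$ with $\hat\Delta\subseteq L\subseteq\Delta\cap\mathbb Z^n$ is called $\hat\Delta$-mediated if every point of $L\setminus\hat\Delta$ is the average of two distinct points of $L\cap(2\mathbb Z)^n$. Let $\Delta^*$ be the largest $\hat\Delta$-mediated set, i.e. the union of all of them. Call $\Delta$ an $H$-simplex if $\Delta^*=\Delta\cap\mathbb Z^n$. A binomial is a polynomial with exactly two terms. (2) If $I\subseteq\Delta^*$, then the following are equivalent: $f\in P_{n,2d}$; $f\in\Sigma_{n,2d}$; $f$ is a finite sum of squares of binomials. (3) In particular, the three conditions in (2) are equivalent whenever $\Delta$ is an $H$-simplex. -/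

import Mathlib

open MvPolynomial

noncomputable section

/-- An exponent vector, seen as a point of `ℝⁿ`. -/
def realPoint {n : ℕ} (u : Fin n →₀ ℕ) : Fin n → ℝ := fun k => (u k : ℝ)

/-- The polytope `conv S ⊆ ℝⁿ` spanned by a set `S` of lattice points. -/
def latticeHull {n : ℕ} (S : Set (Fin n →₀ ℕ)) : Set (Fin n → ℝ) :=
  convexHull ℝ (realPoint '' S)

/-- A lattice point is even if all its entries are even. -/
def IsEvenPoint {n : ℕ} (u : Fin n →₀ ℕ) : Prop := ∀ k, Even (u k)

/-- `P_{n,m}`: the polynomials of degree at most `m` that are nonnegative on `ℝⁿ`. -/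
def nonnegCone (n m : ℕ) : Set (MvPolynomial (Fin n) ℝ) :=
  {p | p.totalDegree ≤ m ∧ ∀ x : Fin n → ℝ, 0 ≤ eval x p}

/-- `Σ_{n,2d}`: the polynomials in `P_{n,2d}` that are finite sums of squares of polynomials
of degree at most `d`. -/
def sosCone (n d : ℕ) : Set (MvPolynomial (Fin n) ℝ) :=
  {p | p ∈ nonnegCone n (2 * d) ∧
    ∃ (k : ℕ) (q : Fin k → MvPolynomial (Fin n) ℝ),
      (∀ i, (q i).totalDegree ≤ d) ∧ p = ∑ i, q i ^ 2}

/-- `p` is a finite sum of squares of binomials, a binomial having exactly two terms. -/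
def IsSumOfBinomialSquares {n : ℕ} (p : MvPolynomial (Fin n) ℝ) : Prop :=
  ∃ (k : ℕ) (u v : Fin k → (Fin n →₀ ℕ)) (s t : Fin k → ℝ),
    (∀ i, u i ≠ v i ∧ s i ≠ 0 ∧ t i ≠ 0) ∧
      p = ∑ i, (monomial (u i) (s i) + monomial (v i) (t i)) ^ 2

/-- `P_Δ^y`, where `Δ` is the simplex with vertices `α 0, …, α n` and `y` is an interior lattice
point of `Δ`: the circuit polynomials `∑ b_j x^{α j} + c x^y` with `b_j > 0` and `c ≠ 0`. -/
def circuitPolynomials {n : ℕ} (α : Fin (n + 1) → (Fin n →₀ ℕ)) (y : Fin n →₀ ℕ) :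
    Set (MvPolynomial (Fin n) ℝ) :=
  {p | AffineIndependent ℝ (fun j => realPoint (α j)) ∧
    realPoint y ∈ interior (latticeHull (Set.range α)) ∧
    ∃ (b : Fin (n + 1) → ℝ) (c : ℝ), (∀ j, 0 < b j) ∧ c ≠ 0 ∧
      p = ∑ j, monomial (α j) (b j) + monomial y c}

/-- The averages of two distinct even points of `L` (they are lattice points, since the two
points are even). -/
def distinctEvenAverages {n : ℕ} (L : Set (Fin n →₀ ℕ)) : Set (Fin n →₀ ℕ) :=
  {β | ∃ s ∈ L, ∃ t ∈ L, s ≠ t ∧ IsEvenPoint s ∧ IsEvenPoint t ∧ s + t = 2 • β}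

/-- `L` is `V`-mediated: `L` is a set of lattice points of `conv V` that contains `V`, and each
point of `L \ V` is the average of two distinct even points of `L`. For `V ⊆ ℕⁿ` the lattice
points of `conv V` all lie in `ℕⁿ`. -/
def IsMediated {n : ℕ} (V L : Set (Fin n →₀ ℕ)) : Prop :=
  (∀ u ∈ L, realPoint u ∈ latticeHull V) ∧ V ⊆ L ∧ L ⊆ distinctEvenAverages L ∪ V

/-- The maximal `V`-mediated set `Δ*`: the union of all `V`-mediated sets. -/
def maximalMediatedSet {n : ℕ} (V : Set (Fin n →₀ ℕ)) : Set (Fin n →₀ ℕ) :=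
  ⋃₀ {L | IsMediated V L}

/-- `Δ*` is itself mediated and contains every mediated set. -/
theorem isGreatest_maximalMediatedSet {n : ℕ} (V : Set (Fin n →₀ ℕ)) :
    IsGreatest {L | IsMediated V L} (maximalMediatedSet V) := by
  refine ⟨⟨?_, ?_, ?_⟩, fun L hL => Set.subset_sUnion_of_mem hL⟩
  · rintro u ⟨L, hL, hu⟩
    exact hL.1 u hu
  · intro u hu
    refine ⟨V, ⟨fun w hw => subset_convexHull ℝ _ ⟨w, hw, rfl⟩, subset_rfl, ?_⟩, hu⟩
    exact Set.subset_union_right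
  · rintro u ⟨L, hL, hu⟩
    rcases hL.2.2 hu with ⟨s, hs, t, ht, h⟩ | h
    · exact Or.inl ⟨s, ⟨L, hL, hs⟩, t, ⟨L, hL, ht⟩, h⟩
    · exact Or.inr h

/-- `Δ = conv V` is an `H`-simplex: `Δ*` consists of all lattice points of `Δ`. -/
def IsHSimplex {n : ℕ} (V : Set (Fin n →₀ ℕ)) : Prop :=
  maximalMediatedSet V = {u | realPoint u ∈ latticeHull V}

end

/-! Write `λ(y)` for the barycentric coordinates of `y` and maximize `∑ a_y ∏ t_j ^ λ_j(y)` over `t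
≥ 0`, `∑ b_j t_j = 1`. A maximizer `t` is positive, and with `M` the maximum the Lagrange conditions
split each `b_j` into positive parts `β_{y,j}`, one for each `y ∈ I` (`exists_stationary_point`).
Some positive point `x` has `x^{α j} = t_j / t_0`, and there `f(x)` is a positive multiple of `1 -
M`; so nonnegativity of `f` forces `M ≤ 1`. Up to a positive factor and a rescaling of the
variables, the summand at `y` is `∑ λ_j(y) x^{α j} - M x^y` (`exists_circuit_decomposition`), which
is nonnegative by weighted AM-GM.

If `y ∈ Δ*`, the case `M = 1` of this circuit is a sum of binomial squares: for `z = (s + t) / 2`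
with `s`, `t` even, `x^s + x^t - 2 x^z` is the square of a binomial, and combining these relations
eliminates every point of `Δ*` that is not a vertex (`exists_isBalancedBinomialSum_sub_monomial`).
The case `M < 1` adds only positive even monomials. -/

/-! ### Closure properties of sums of binomial squares. -/

lemma IsSumOfBinomialSquares.zero {n : ℕ} :
    IsSumOfBinomialSquares (0 : MvPolynomial (Fin n) ℝ) :=
  ⟨0, Fin.elim0, Fin.elim0, Fin.elim0, Fin.elim0, fun i => i.elim0, by simp⟩

lemma IsSumOfBinomialSquares.add {n : ℕ} {p q : MvPolynomial (Fin n) ℝ}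
    (hp : IsSumOfBinomialSquares p) (hq : IsSumOfBinomialSquares q) :
    IsSumOfBinomialSquares (p + q) := by
  obtain ⟨k, u, v, s, t, h, rfl⟩ := hp
  obtain ⟨l, u', v', s', t', h', rfl⟩ := hq
  refine ⟨k + l, Fin.append u u', Fin.append v v', Fin.append s s', Fin.append t t',
    fun i => ?_, ?_⟩
  · refine Fin.addCases (fun i => ?_) (fun i => ?_) i
    · simpa using h i
    · simpa using h' i
  · simp [Fin.sum_univ_add]

lemma IsSumOfBinomialSquares.sum {n : ℕ} {κ : Type*} {s : Finset κ}
    {p : κ → MvPolynomial (Fin n) ℝ} (h : ∀ i ∈ s, IsSumOfBinomialSquares (p i)) :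
    IsSumOfBinomialSquares (∑ i ∈ s, p i) :=
  Finset.sum_induction _ _ (fun _ _ => .add) .zero h

lemma IsSumOfBinomialSquares.sq {n : ℕ} {u v : Fin n →₀ ℕ} (huv : u ≠ v) {s t : ℝ}
    (hs : s ≠ 0) (ht : t ≠ 0) :
    IsSumOfBinomialSquares ((monomial u s + monomial v t) ^ 2) :=
  ⟨1, fun _ => u, fun _ => v, fun _ => s, fun _ => t, fun _ => ⟨huv, hs, ht⟩, by simp⟩

lemma IsSumOfBinomialSquares.smul {n : ℕ} {p : MvPolynomial (Fin n) ℝ}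
    (hp : IsSumOfBinomialSquares p) {c : ℝ} (hc : 0 ≤ c) : IsSumOfBinomialSquares (c • p) := by
  rcases hc.eq_or_lt with rfl | hc
  · simpa using IsSumOfBinomialSquares.zero
  obtain ⟨k, u, v, s, t, h, rfl⟩ := hp
  have hc' : √c ≠ 0 := (Real.sqrt_pos.2 hc).ne'
  refine ⟨k, u, v, fun i => √c * s i, fun i => √c * t i,
    fun i => ⟨(h i).1, mul_ne_zero hc' (h i).2.1, mul_ne_zero hc' (h i).2.2⟩, ?_⟩
  rw [Finset.smul_sum]
  refine Finset.sum_congr rfl fun i _ => ?_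
  have e (w : Fin n →₀ ℕ) (r : ℝ) : monomial w (√c * r) = √c • monomial w r := by
    rw [smul_monomial, smul_eq_mul]
  simp only [e]
  rw [← smul_add, smul_pow, Real.sq_sqrt hc.le]

/-- Two distinct even monomials with positive coefficients add up to two binomial squares. -/
lemma isSumOfBinomialSquares_even_pair {n : ℕ} {u v : Fin n →₀ ℕ} (huv : u ≠ v) {s t : ℝ}
    (hs : 0 < s) (ht : 0 < t) :
    IsSumOfBinomialSquares (monomial (u + u) s + monomial (v + v) t) := by
  have hs' : √(s / 2) ≠ 0 := (Real.sqrt_pos.2 (by positivity)).ne'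
  have ht' : √(t / 2) ≠ 0 := (Real.sqrt_pos.2 (by positivity)).ne'
  have h := (IsSumOfBinomialSquares.sq huv hs' ht').add
    (IsSumOfBinomialSquares.sq huv hs' (neg_ne_zero.2 ht'))
  convert h using 1
  have e1 : (monomial (u + u) s : MvPolynomial (Fin n) ℝ) = 2 * monomial u (√(s / 2)) ^ 2 := by
    rw [pow_two, monomial_mul, Real.mul_self_sqrt (by positivity), two_mul, ← map_add, add_halves]
  have e2 : (monomial (v + v) t : MvPolynomial (Fin n) ℝ) = 2 * monomial v (√(t / 2)) ^ 2 := by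
    rw [pow_two, monomial_mul, Real.mul_self_sqrt (by positivity), two_mul, ← map_add, add_halves]
  rw [e1, e2, map_neg]
  ring

/-- The substitution `x_k ↦ c_k x_k`. -/
noncomputable def scaleVars {n : ℕ} (c : Fin n → ℝ) :
    MvPolynomial (Fin n) ℝ →ₐ[ℝ] MvPolynomial (Fin n) ℝ :=
  aeval fun k => C (c k) * X k

lemma scaleVars_monomial {n : ℕ} (c : Fin n → ℝ) (u : Fin n →₀ ℕ) (s : ℝ) :
    scaleVars c (monomial u s) = monomial u (s * ∏ k, c k ^ u k) := by
  rw [scaleVars, aeval_monomial, monomial_eq, Finsupp.prod_fintype _ _ (by simp),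
    Finsupp.prod_fintype _ _ (by simp), algebraMap_eq]
  simp only [mul_pow, Finset.prod_mul_distrib, map_mul, map_prod, map_pow, mul_assoc]

lemma eval_scaleVars {n : ℕ} (c x : Fin n → ℝ) (p : MvPolynomial (Fin n) ℝ) :
    eval x (scaleVars c p) = eval (fun k => c k * x k) p := by
  induction p using MvPolynomial.induction_on' with
  | monomial u s =>
    rw [scaleVars_monomial]
    simp only [eval_monomial]
    rw [Finsupp.prod_fintype _ _ (by simp), Finsupp.prod_fintype _ _ (by simp)]
    simp only [mul_pow, Finset.prod_mul_distrib, mul_assoc]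
  | add p q hp hq => simp [hp, hq]

lemma IsSumOfBinomialSquares.scaleVars {n : ℕ} {p : MvPolynomial (Fin n) ℝ}
    (hp : IsSumOfBinomialSquares p) {c : Fin n → ℝ} (hc : ∀ k, c k ≠ 0) :
    IsSumOfBinomialSquares (scaleVars c p) := by
  obtain ⟨k, u, v, s, t, h, rfl⟩ := hp
  have hc' (w : Fin n →₀ ℕ) : ∏ k, c k ^ w k ≠ 0 :=
    Finset.prod_ne_zero_iff.2 fun k _ => pow_ne_zero _ (hc k)
  refine ⟨k, u, v, fun i => s i * ∏ k, c k ^ u i k, fun i => t i * ∏ k, c k ^ v i k,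
    fun i => ⟨(h i).1, mul_ne_zero (h i).2.1 (hc' _), mul_ne_zero (h i).2.2 (hc' _)⟩, ?_⟩
  simp [scaleVars_monomial]

/-! ### Degrees in sums of squares. -/

/-- Two exponents of total degree `2m` either both have degree `m`, or one of them exceeds `m` and
has coefficient zero in `q`. -/
lemma homogeneousComponent_sq_of_totalDegree_le {n m : ℕ} {q : MvPolynomial (Fin n) ℝ}
    (h : q.totalDegree ≤ m) :
    homogeneousComponent (m + m) (q ^ 2) = homogeneousComponent m q ^ 2 := by
  ext w
  rw [coeff_homogeneousComponent]
  split_ifs with hw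
  · rw [pow_two, pow_two, coeff_mul, coeff_mul]
    refine Finset.sum_congr rfl fun x hx => ?_
    have hx' : x.1.degree + x.2.degree = m + m := by
      rw [← hw, ← Finset.HasAntidiagonal.mem_antidiagonal.1 hx, map_add]
    rw [coeff_homogeneousComponent, coeff_homogeneousComponent]
    have key (y : Fin n →₀ ℕ) (hy : m < y.degree) : coeff y q = 0 :=
      coeff_eq_zero_of_totalDegree_lt (lt_of_le_of_lt h hy)
    split_ifs with h1 h2 h2
    · rfl
    · omega
    · omega
    · rcases lt_or_ge m x.1.degree with h3 | h3
      · simp [key _ h3]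
      · simp [key x.2 (by omega)]
  · refine (((homogeneousComponent_isHomogeneous m q).pow 2).coeff_eq_zero ?_).symm
    omega

/-- There is no cancellation of top degree terms in a sum of squares. -/
lemma totalDegree_le_of_sum_sq {n d k : ℕ} (q : Fin k → MvPolynomial (Fin n) ℝ)
    (h : (∑ i, q i ^ 2).totalDegree ≤ 2 * d) (i : Fin k) : (q i).totalDegree ≤ d := by
  by_contra! hi
  obtain ⟨j, -, hj⟩ := Finset.exists_max_image Finset.univ (fun i => (q i).totalDegree)
    ⟨i, Finset.mem_univ i⟩
  set m := (q j).totalDegree with hm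
  have hdm : d < m := hi.trans_le (hj i (Finset.mem_univ i))
  have h0 : ∑ i, homogeneousComponent m (q i) ^ 2 = 0 := by
    rw [← homogeneousComponent_eq_zero (m + m) (∑ i, q i ^ 2) (by omega), map_sum]
    exact Finset.sum_congr rfl fun i hi =>
      (homogeneousComponent_sq_of_totalDegree_le (hj i hi)).symm
  -- Over `ℝ` a vanishing sum of squares of values makes each value vanish, and a polynomial that
  -- vanishes everywhere is zero.
  have hj0 : homogeneousComponent m (q j) = 0 := by
    refine MvPolynomial.funext fun x => ?_
    have h1 := congrArg (eval x) h0
    simp only [map_sum, map_pow, map_zero] at h1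
    rw [Finset.sum_eq_zero_iff_of_nonneg fun i _ => sq_nonneg _] at h1
    simpa using h1 j (Finset.mem_univ j)
  have hq : q j ≠ 0 := by
    intro h
    rw [h, totalDegree_zero] at hm
    omega
  obtain ⟨w, hw, hwm⟩ := Finset.exists_mem_eq_sup (q j).support (support_nonempty.2 hq)
    (fun s : Fin n →₀ ℕ => s.sum fun _ e => e)
  have h2 := congrArg (coeff w) hj0
  rw [coeff_homogeneousComponent, if_pos, coeff_zero] at h2
  · exact (mem_support_iff.1 hw) h2
  · exact hwm.symm

lemma IsSumOfBinomialSquares.mem_sosCone {n d : ℕ} {p : MvPolynomial (Fin n) ℝ}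
    (hp : IsSumOfBinomialSquares p) (hd : p.totalDegree ≤ 2 * d) : p ∈ sosCone n d := by
  obtain ⟨k, u, v, s, t, -, rfl⟩ := hp
  refine ⟨⟨hd, fun x => ?_⟩, k, _, fun i => totalDegree_le_of_sum_sq _ hd i, rfl⟩
  simp only [map_sum, map_pow]
  exact Finset.sum_nonneg fun i _ => sq_nonneg _

/-! ### Elimination in mediated sets. -/

/-- The linear functional on polynomials that sends the monomial `x^u` to `φ u`. -/
noncomputable def monomialFunctional {n : ℕ} (φ : (Fin n →₀ ℕ) → ℝ) :
    MvPolynomial (Fin n) ℝ →ₗ[ℝ] ℝ :=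
  (basisMonomials (Fin n) ℝ).constr ℝ φ

lemma monomialFunctional_monomial {n : ℕ} (φ : (Fin n →₀ ℕ) → ℝ) (u : Fin n →₀ ℕ) (s : ℝ) :
    monomialFunctional φ (monomial u s) = s * φ u := by
  have h : monomialFunctional φ (monomial u 1) = φ u :=
    (basisMonomials (Fin n) ℝ).constr_basis ℝ φ u
  rw [← mul_one s, ← smul_eq_mul, ← smul_monomial, map_smul, h, smul_eq_mul, smul_eq_mul, mul_one]

lemma monomialFunctional_eq_sum {n : ℕ} (φ : (Fin n →₀ ℕ) → ℝ) (p : MvPolynomial (Fin n) ℝ) :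
    monomialFunctional φ p = ∑ u ∈ p.support, coeff u p * φ u := by
  conv_lhs => rw [p.as_sum]
  simp only [map_sum, monomialFunctional_monomial]

/-- Sums of binomial squares that, as signed measures on the exponents, have total mass and
barycenter zero and a nonnegative second moment. -/
structure IsBalancedBinomialSum {n : ℕ} (p : MvPolynomial (Fin n) ℝ) : Prop where
  isSum : IsSumOfBinomialSquares p
  mass : monomialFunctional (fun _ => 1) p = 0
  barycenter : ∀ k, monomialFunctional (fun u => (u k : ℝ)) p = 0
  moment : 0 ≤ monomialFunctional (fun u => ∑ k, (u k : ℝ) ^ 2) p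

lemma IsBalancedBinomialSum.zero {n : ℕ} :
    IsBalancedBinomialSum (0 : MvPolynomial (Fin n) ℝ) :=
  ⟨.zero, map_zero _, fun _ => map_zero _, (map_zero _).ge⟩

lemma IsBalancedBinomialSum.add {n : ℕ} {p q : MvPolynomial (Fin n) ℝ}
    (hp : IsBalancedBinomialSum p) (hq : IsBalancedBinomialSum q) :
    IsBalancedBinomialSum (p + q) where
  isSum := hp.isSum.add hq.isSum
  mass := by rw [map_add, hp.mass, hq.mass, add_zero]
  barycenter k := by rw [map_add, hp.barycenter, hq.barycenter, add_zero]
  moment := by rw [map_add]; exact add_nonneg hp.moment hq.moment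

lemma IsBalancedBinomialSum.smul {n : ℕ} {p : MvPolynomial (Fin n) ℝ}
    (hp : IsBalancedBinomialSum p) {c : ℝ} (hc : 0 ≤ c) : IsBalancedBinomialSum (c • p) where
  isSum := hp.isSum.smul hc
  mass := by rw [map_smul, hp.mass, smul_zero]
  barycenter k := by rw [map_smul, hp.barycenter, smul_zero]
  moment := by rw [map_smul]; exact smul_nonneg hc hp.moment

lemma sq_monomial_sub {n : ℕ} (u v : Fin n →₀ ℕ) :
    ((monomial u 1 + monomial v (-1)) ^ 2 : MvPolynomial (Fin n) ℝ) =
      monomial (u + u) 1 + monomial (v + v) 1 - monomial (u + v) 2 := by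
  have h : (monomial (u + v) 2 : MvPolynomial (Fin n) ℝ) = 2 * (monomial u 1 * monomial v 1) := by
    rw [monomial_mul, two_mul, ← map_add]; norm_num
  have h1 : (monomial (u + u) 1 : MvPolynomial (Fin n) ℝ) = monomial u 1 * monomial u 1 := by
    rw [monomial_mul, one_mul]
  have h2 : (monomial (v + v) 1 : MvPolynomial (Fin n) ℝ) = monomial v 1 * monomial v 1 := by
    rw [monomial_mul, one_mul]
  rw [h, h1, h2, map_neg]
  ring

/-- Parallelogram law: `|2u|² + |2v|² - 2|u + v|² = 2|u - v|²`. Strictness is what makes the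
elimination solvable. -/
lemma moment_sq_monomial_sub_pos {n : ℕ} {u v : Fin n →₀ ℕ} (huv : u ≠ v) :
    0 < monomialFunctional (fun w => ∑ k, (w k : ℝ) ^ 2)
      ((monomial u 1 + monomial v (-1)) ^ 2 : MvPolynomial (Fin n) ℝ) := by
  have h : monomialFunctional (fun w => ∑ k, (w k : ℝ) ^ 2)
      ((monomial u 1 + monomial v (-1)) ^ 2 : MvPolynomial (Fin n) ℝ) =
        ∑ k, 2 * ((u k : ℝ) - v k) ^ 2 := by
    rw [sq_monomial_sub, map_sub, map_add]
    simp only [monomialFunctional_monomial, Finset.mul_sum]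
    rw [← Finset.sum_add_distrib, ← Finset.sum_sub_distrib]
    refine Finset.sum_congr rfl fun k _ => ?_
    simp only [Finsupp.add_apply]
    push_cast
    ring
  rw [h]
  obtain ⟨k, hk⟩ := DFunLike.ne_iff.1 huv
  refine Finset.sum_pos' (fun k _ => by positivity) ⟨k, Finset.mem_univ k, ?_⟩
  have : (u k : ℝ) - v k ≠ 0 := sub_ne_zero.2 (by exact_mod_cast hk)
  positivity

lemma isBalancedBinomialSum_sq {n : ℕ} {u v : Fin n →₀ ℕ} (huv : u ≠ v) :
    IsBalancedBinomialSum
      ((monomial u 1 + monomial v (-1)) ^ 2 : MvPolynomial (Fin n) ℝ) where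
  isSum := .sq huv one_ne_zero (by norm_num)
  mass := by
    rw [sq_monomial_sub, map_sub, map_add]
    simp only [monomialFunctional_monomial]
    norm_num
  barycenter k := by
    rw [sq_monomial_sub, map_sub, map_add]
    simp only [monomialFunctional_monomial, Finsupp.add_apply]
    push_cast
    ring
  moment := (moment_sq_monomial_sub_pos huv).le

/-- A nonnegative combination of monomials of mass one in which `x^β` has coefficient at
least one is equal to `x^β`. -/
lemma eq_monomial_of_one_le_coeff {n : ℕ} {p : MvPolynomial (Fin n) ℝ}
    (hp : ∀ u, 0 ≤ coeff u p) (hmass : monomialFunctional (fun _ => 1) p = 1)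
    {β : Fin n →₀ ℕ} (hβ : 1 ≤ coeff β p) : p = monomial β 1 := by
  have hmem : β ∈ p.support := mem_support_iff.2 (by linarith)
  rw [monomialFunctional_eq_sum, ← Finset.add_sum_erase _ _ hmem] at hmass
  simp only [mul_one] at hmass
  have h0 : 0 ≤ ∑ u ∈ p.support.erase β, coeff u p := Finset.sum_nonneg fun u _ => hp u
  have h1 : ∑ u ∈ p.support.erase β, coeff u p = 0 := by linarith
  rw [Finset.sum_eq_zero_iff_of_nonneg fun u _ => hp u] at h1
  ext u
  rw [coeff_monomial]
  split_ifs with h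
  · subst h; linarith
  · by_contra h2
    exact h2 (h1 u (Finset.mem_erase.2 ⟨Ne.symm h, mem_support_iff.2 h2⟩))

/-- Eliminating finitely many points of a mediated set: modulo balanced sums of binomial squares
every `x^β` is a convex combination of monomials outside of the eliminated set. -/
lemma exists_isBalancedBinomialSum_sub_monomial {n : ℕ} {V L : Set (Fin n →₀ ℕ)}
    (hL : L ⊆ distinctEvenAverages L ∪ V) (B : Finset (Fin n →₀ ℕ))
    (hB : ∀ u ∈ B, u ∈ L ∧ u ∉ V) (β : Fin n →₀ ℕ) (hβ : β ∈ L) :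
    ∃ p : MvPolynomial (Fin n) ℝ, (∀ u, 0 ≤ coeff u p) ∧
      (∀ u, coeff u p ≠ 0 → u ∈ L ∧ u ∉ B) ∧ IsBalancedBinomialSum (p - monomial β 1) := by
  induction B using Finset.induction_on generalizing β with
  | empty =>
    refine ⟨monomial β 1, fun u => ?_, fun u hu => ?_, ?_⟩
    · rw [coeff_monomial]; split_ifs <;> norm_num
    · rw [coeff_monomial] at hu
      have : β = u := by by_contra h; simp [h] at hu
      exact ⟨this ▸ hβ, by simp⟩
    · rw [sub_self]; exact .zero
  | insert z B hz ih =>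
    have ih' := fun β hβ => ih (fun u hu => hB u (Finset.mem_insert_of_mem hu)) β hβ
    obtain ⟨hzL, hzV⟩ := hB z (Finset.mem_insert_self z B)
    obtain ⟨s, hs, t, ht, hst, hse, hte, hsum⟩ := (hL hzL).resolve_right hzV
    obtain ⟨u, rfl⟩ : ∃ u, s = u + u := by
      choose u hu using hse
      exact ⟨Finsupp.equivFunOnFinite.symm u, by ext k; simpa using hu k⟩
    obtain ⟨v, rfl⟩ : ∃ v, t = v + v := by
      choose v hv using hte
      exact ⟨Finsupp.equivFunOnFinite.symm v, by ext k; simpa using hv k⟩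
    have huv : u ≠ v := fun h => hst (by rw [h])
    have hzuv : z = u + v := by
      ext k
      have := DFunLike.congr_fun hsum k
      simp only [Finsupp.add_apply, Finsupp.smul_apply, smul_eq_mul] at this ⊢
      omega
    obtain ⟨ps, hps0, hpsL, hps⟩ := ih' _ hs
    obtain ⟨pt, hpt0, hptL, hpt⟩ := ih' _ ht
    -- `q` represents `x^z` and avoids `B`, but may still contain `x^z` itself.
    set q : MvPolynomial (Fin n) ℝ := (1 / 2 : ℝ) • ps + (1 / 2 : ℝ) • pt with hq
    have hqz : q - monomial z 1 = (1 / 2 : ℝ) • (ps - monomial (u + u) 1) +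
        (1 / 2 : ℝ) • (pt - monomial (v + v) 1) +
        (1 / 2 : ℝ) • (monomial u 1 + monomial v (-1)) ^ 2 := by
      have : (monomial z 1 : MvPolynomial (Fin n) ℝ) = (1 / 2 : ℝ) • monomial (u + v) 2 := by
        rw [smul_monomial, hzuv]; norm_num
      rw [sq_monomial_sub, hq, this]
      module
    have hqbal : IsBalancedBinomialSum (q - monomial z 1) := by
      rw [hqz]
      exact ((hps.smul (by norm_num)).add (hpt.smul (by norm_num))).add
        ((isBalancedBinomialSum_sq huv).smul (by norm_num))
    have hqpos : 0 < monomialFunctional (fun u => ∑ k, (u k : ℝ) ^ 2) (q - monomial z 1) := by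
      rw [hqz]
      simp only [map_add, map_smul, smul_eq_mul]
      have h1 := hps.moment
      have h2 := hpt.moment
      have h3 := moment_sq_monomial_sub_pos huv
      linarith
    have hq0 (w : Fin n →₀ ℕ) : 0 ≤ coeff w q := by
      simp only [hq, coeff_add, coeff_smul, smul_eq_mul]
      have := hps0 w
      have := hpt0 w
      positivity
    have hqL (w : Fin n →₀ ℕ) (hw : coeff w q ≠ 0) : w ∈ L ∧ w ∉ B := by
      by_cases h : coeff w ps = 0
      · refine hptL w fun h' => hw ?_
        simp [hq, h, h']
      · exact hpsL w h
    have hqmass : monomialFunctional (fun _ => 1) q = 1 := by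
      have := hqbal.mass
      rw [map_sub, monomialFunctional_monomial] at this
      linarith
    -- Otherwise `q = x^z`, contradicting the strictly positive second moment of `q - x^z`.
    have hqlt : coeff z q < 1 := by
      by_contra! h
      rw [eq_monomial_of_one_le_coeff hq0 hqmass h, sub_self, map_zero] at hqpos
      exact lt_irrefl _ hqpos
    set c := coeff z q with hc
    have hc1 : 0 < 1 - c := by linarith
    obtain ⟨p, hp0, hpL, hp⟩ := ih' β hβ
    -- As `c < 1`, the relation can be solved for `x^z`: it is replaced in `p` by `(q - c x^z) / (1
    -- - c)`.
    refine ⟨p - monomial z (coeff z p) +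
      (coeff z p * (1 - c)⁻¹) • (q - monomial z c), fun w => ?_, fun w hw => ?_, ?_⟩
    · simp only [coeff_add, coeff_sub, coeff_smul, coeff_monomial, smul_eq_mul]
      split_ifs with h
      · subst h; simp [hc]
      · simp only [sub_zero]
        have := hp0 w
        have := hp0 z
        have := hq0 w
        positivity
    · simp only [coeff_add, coeff_sub, coeff_smul, coeff_monomial, smul_eq_mul] at hw
      split_ifs at hw with h
      · subst h; simp [hc] at hw
      · simp only [sub_zero] at hw
        have : w ∈ L ∧ w ∉ B := by
          by_cases h' : coeff w p = 0
          · refine hqL w fun h'' => hw ?_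
            simp [h', h'']
          · exact hpL w h'
        exact ⟨this.1, by simp [this.2, Ne.symm h]⟩
    · have : p - monomial z (coeff z p) + (coeff z p * (1 - c)⁻¹) • (q - monomial z c) -
          monomial β 1 = (p - monomial β 1) +
            (coeff z p * (1 - c)⁻¹) • (q - monomial z 1) := by
        have e (r : ℝ) : (monomial z r : MvPolynomial (Fin n) ℝ) = r • monomial z 1 := by
          rw [smul_monomial, smul_eq_mul, mul_one]
        have e1 : coeff z p = coeff z p * (1 - c)⁻¹ * (1 - c) := by
          rw [mul_assoc, inv_mul_cancel₀ hc1.ne', mul_one]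
        rw [e c, e (coeff z p)]
        nth_rw 1 [e1]
        module
      rw [this]
      exact hp.add (hqbal.smul (mul_nonneg (hp0 z) (inv_nonneg.2 hc1.le)))

/-! ### Barycentric coordinates and circuit polynomials of the simplex. -/

lemma exists_affineBasis_of_affineIndependent {n : ℕ} {α : Fin (n + 1) → (Fin n →₀ ℕ)}
    (hα : AffineIndependent ℝ (fun j => realPoint (α j))) :
    ∃ B : AffineBasis (Fin (n + 1)) ℝ (Fin n → ℝ), ∀ j, B j = realPoint (α j) :=
  ⟨⟨_, hα, by rw [hα.affineSpan_eq_top_iff_card_eq_finrank_add_one]; simp⟩, fun _ => rfl⟩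

section Simplex

variable {n : ℕ} {α : Fin (n + 1) → (Fin n →₀ ℕ)} {B : AffineBasis (Fin (n + 1)) ℝ (Fin n → ℝ)}

lemma latticeHull_range_eq (hB : ∀ j, B j = realPoint (α j)) :
    latticeHull (Set.range α) = convexHull ℝ (Set.range B) := by
  have : (B : Fin (n + 1) → Fin n → ℝ) = realPoint ∘ α := funext hB
  rw [latticeHull, this, Set.range_comp]

lemma sum_coord_mul (hB : ∀ j, B j = realPoint (α j)) (y : Fin n →₀ ℕ) (k : Fin n) :
    ∑ j, B.coord j (realPoint y) * (α j k : ℝ) = y k := by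
  have h := congrFun (B.linear_combination_coord_eq_self (realPoint y)) k
  rw [Finset.sum_apply] at h
  simpa [hB, realPoint] using h

lemma coord_eq_of_sum_eq (hB : ∀ j, B j = realPoint (α j)) {y : Fin n →₀ ℕ}
    {w : Fin (n + 1) → ℝ} (hw : ∑ j, w j = 1) (hwy : ∀ k, ∑ j, w j * (α j k : ℝ) = y k)
    (j : Fin (n + 1)) : B.coord j (realPoint y) = w j := by
  rw [← B.coord_apply_combination_of_mem (Finset.mem_univ j) hw]
  congr 1
  rw [Finset.univ.affineCombination_eq_linear_combination _ _ hw]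
  ext k
  rw [Finset.sum_apply]
  simpa [hB, realPoint] using (hwy k).symm

lemma coord_pos_of_mem_interior (hB : ∀ j, B j = realPoint (α j)) {y : Fin n →₀ ℕ}
    (hy : realPoint y ∈ interior (latticeHull (Set.range α))) (j : Fin (n + 1)) :
    0 < B.coord j (realPoint y) := by
  rw [latticeHull_range_eq hB, B.interior_convexHull] at hy
  exact hy j

lemma vertices_injective (hB : ∀ j, B j = realPoint (α j)) : Function.Injective α := by
  intro i j h
  exact B.ind.injective (by rw [hB, hB, h])

/-- For `n > 0` a vertex has some coordinate zero; for `n = 0` the only vertex would be interior. -/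
lemma ne_vertex_of_mem_interior (hn : 0 < n) (hB : ∀ j, B j = realPoint (α j)) {y : Fin n →₀ ℕ}
    (hy : realPoint y ∈ interior (latticeHull (Set.range α))) (j : Fin (n + 1)) : y ≠ α j := by
  rintro rfl
  have : Nontrivial (Fin (n + 1)) := Fin.nontrivial_iff_two_le.2 (by omega)
  obtain ⟨i, hi⟩ := exists_ne j
  have h := coord_pos_of_mem_interior hB hy i
  rw [← hB, B.coord_apply_ne hi] at h
  exact lt_irrefl _ h

lemma finite_of_subset_latticeHull (hB : ∀ j, B j = realPoint (α j)) {L : Set (Fin n →₀ ℕ)}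
    (hL : ∀ u ∈ L, realPoint u ∈ latticeHull (Set.range α)) : L.Finite := by
  refine (Set.finite_Iic (∑ j, α j)).subset fun u hu k => ?_
  have h := hL u hu
  rw [latticeHull_range_eq hB, B.convexHull_eq_nonneg_coord] at h
  have h1 : (u k : ℝ) ≤ ∑ j, (α j k : ℝ) := by
    rw [← sum_coord_mul hB]
    refine Finset.sum_le_sum fun j _ => mul_le_of_le_one_left (by positivity) ?_
    rw [← B.sum_coord_apply_eq_one (realPoint u)]
    exact Finset.single_le_sum (fun i _ => h i) (Finset.mem_univ j)
  rw [Finsupp.finsetSum_apply]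
  exact_mod_cast h1

/-- For `y` in the maximal mediated set, the agiform of the simplex at `y` is a sum of binomial
squares. -/
lemma isSumOfBinomialSquares_agiform (hB : ∀ j, B j = realPoint (α j)) {y : Fin n →₀ ℕ}
    (hy : y ∈ maximalMediatedSet (Set.range α)) :
    IsSumOfBinomialSquares
      (∑ j, monomial (α j) (B.coord j (realPoint y)) - monomial y 1) := by
  obtain ⟨hhull, -, hmed⟩ := (isGreatest_maximalMediatedSet (Set.range α)).1
  have hfin := (finite_of_subset_latticeHull hB hhull).subset
    (Set.sdiff_subset (t := Set.range α))
  -- All points of `Δ*` other than vertices are eliminated, so `p` is supported on the vertices.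
  obtain ⟨p, hp0, hpL, hp⟩ := exists_isBalancedBinomialSum_sub_monomial hmed hfin.toFinset
    (fun u hu => by simpa using hu) y hy
  have hpV (u : Fin n →₀ ℕ) (hu : coeff u p ≠ 0) : u ∈ Set.range α := by
    by_contra h
    exact (hpL u hu).2 (by simpa using ⟨(hpL u hu).1, by simpa using h⟩)
  have hinj := vertices_injective hB
  have hpsum : p = ∑ j, monomial (α j) (coeff (α j) p) := by
    ext u
    rw [coeff_sum]
    simp only [coeff_monomial]
    by_cases hu : u ∈ Set.range α
    · obtain ⟨i, rfl⟩ := hu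
      rw [Finset.sum_eq_single i (fun j _ hj => if_neg fun h => hj (hinj h)) (by simp)]
      simp
    · rw [Finset.sum_eq_zero fun j _ => if_neg fun h => hu ⟨j, h⟩]
      exact not_imp_comm.1 (hpV u) hu
  have hfun (φ : (Fin n →₀ ℕ) → ℝ) :
      monomialFunctional φ p = ∑ j, coeff (α j) p * φ (α j) := by
    conv_lhs => rw [hpsum]
    simp only [map_sum, monomialFunctional_monomial]
  have hmass := hp.mass
  rw [map_sub, hfun, monomialFunctional_monomial] at hmass
  -- Zero mass and zero barycenter of `p - x^y` force the coefficients of `p` to be the barycentric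
  -- coordinates of `y`.
  have hcoord := coord_eq_of_sum_eq hB (y := y) (w := fun j => coeff (α j) p)
    (by simp only [mul_one] at hmass; linarith) fun k => by
      have := hp.barycenter k
      rw [map_sub, hfun, monomialFunctional_monomial] at this
      linarith
  simp only [hcoord]
  rw [← hpsum]
  exact hp.isSum

lemma isSumOfBinomialSquares_sum_vertices (hn : 0 < n) (hB : ∀ j, B j = realPoint (α j))
    (heven : ∀ j, IsEvenPoint (α j)) {c : Fin (n + 1) → ℝ} (hc : ∀ j, 0 < c j) :
    IsSumOfBinomialSquares (∑ j, monomial (α j) (c j)) := by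
  have hhalf (j : Fin (n + 1)) : ∃ u, α j = u + u := by
    choose u hu using heven j
    exact ⟨Finsupp.equivFunOnFinite.symm u, by ext k; simpa using hu k⟩
  choose u hu using hhalf
  -- The term at `α 0` is cut into `n` equal parts, one to pair with each other vertex; this needs
  -- `n > 0`.
  have h0 : (monomial (α 0) (c 0) : MvPolynomial (Fin n) ℝ) =
      ∑ _j : Fin n, monomial (α 0) (c 0 / n) := by
    rw [← map_sum]
    congr 1
    have : (n : ℝ) ≠ 0 := by positivity
    simp
    field_simp
  rw [Fin.sum_univ_succ, h0, ← Finset.sum_add_distrib]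
  refine .sum fun j _ => ?_
  rw [hu 0, hu j.succ]
  refine isSumOfBinomialSquares_even_pair (fun h => ?_) (div_pos (hc 0) (by positivity)) (hc _)
  exact (Fin.succ_ne_zero j).symm (vertices_injective hB (by rw [hu 0, hu j.succ, h]))

/-- The circuit is `M` times the agiform plus `1 - M` times its vertex part. -/
lemma isSumOfBinomialSquares_circuit (hn : 0 < n) (hB : ∀ j, B j = realPoint (α j))
    (heven : ∀ j, IsEvenPoint (α j)) {y : Fin n →₀ ℕ}
    (hyint : realPoint y ∈ interior (latticeHull (Set.range α)))
    (hy : y ∈ maximalMediatedSet (Set.range α)) {M : ℝ} (hM0 : 0 ≤ M) (hM1 : M ≤ 1) :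
    IsSumOfBinomialSquares
      (∑ j, monomial (α j) (B.coord j (realPoint y)) - monomial y M) := by
  have h := ((isSumOfBinomialSquares_agiform hB hy).smul hM0).add
    ((isSumOfBinomialSquares_sum_vertices hn hB heven
      (coord_pos_of_mem_interior hB hyint)).smul (sub_nonneg.2 hM1))
  convert h using 1
  have e : (monomial y M : MvPolynomial (Fin n) ℝ) = M • monomial y 1 := by
    rw [smul_monomial, smul_eq_mul, mul_one]
  rw [e]
  module

/-- Weighted AM-GM at `|x|`: even vertices do not see signs, and the geometric mean of the `|x|^{α
j}` is `|x|^y`. -/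
lemma eval_circuit_nonneg (hB : ∀ j, B j = realPoint (α j))
    (heven : ∀ j, IsEvenPoint (α j)) {y : Fin n →₀ ℕ}
    (hy : realPoint y ∈ interior (latticeHull (Set.range α))) {M : ℝ} (hM0 : 0 ≤ M) (hM1 : M ≤ 1)
    (x : Fin n → ℝ) :
    0 ≤ eval x (∑ j, monomial (α j) (B.coord j (realPoint y)) - monomial y M) := by
  have hpos := coord_pos_of_mem_interior hB hy
  have hprod (u : Fin n →₀ ℕ) (s : ℝ) :
      eval x (monomial u s) = s * ∏ k, x k ^ u k := by
    rw [eval_monomial, Finsupp.prod_fintype _ _ (by simp)]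
  have habs (j : Fin (n + 1)) : ∏ k, x k ^ α j k = ∏ k, |x k| ^ α j k :=
    Finset.prod_congr rfl fun k _ => ((heven j k).pow_abs _).symm
  have hamgm := Real.geom_mean_le_arith_mean_weighted Finset.univ
    (fun j => B.coord j (realPoint y)) (fun j => ∏ k, |x k| ^ α j k)
    (fun j _ => (hpos j).le) (B.sum_coord_apply_eq_one _)
    (fun j _ => Finset.prod_nonneg fun k _ => by positivity)
  have hgeom : ∏ j, (∏ k, |x k| ^ α j k) ^ B.coord j (realPoint y) = ∏ k, |x k| ^ y k := by
    have (j : Fin (n + 1)) : (∏ k, |x k| ^ α j k) ^ B.coord j (realPoint y) =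
        ∏ k, |x k| ^ (B.coord j (realPoint y) * (α j k : ℝ)) := by
      rw [← Real.finsetProd_rpow _ _ fun k _ => by positivity]
      refine Finset.prod_congr rfl fun k _ => ?_
      rw [← Real.rpow_natCast, ← Real.rpow_mul (abs_nonneg _), mul_comm]
    simp only [this]
    rw [Finset.prod_comm]
    refine Finset.prod_congr rfl fun k _ => ?_
    rw [← Real.rpow_sum_of_nonneg (abs_nonneg _)
      fun j _ => mul_nonneg (hpos j).le (by positivity), sum_coord_mul hB, Real.rpow_natCast]
  rw [hgeom] at hamgm
  simp only [map_sub, map_sum, hprod, habs]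
  have h1 : M * ∏ k, x k ^ y k ≤ ∏ k, |x k| ^ y k := by
    calc M * ∏ k, x k ^ y k ≤ M * ∏ k, |x k| ^ y k := by
          refine mul_le_mul_of_nonneg_left ?_ hM0
          refine (le_abs_self _).trans_eq ?_
          rw [Finset.abs_prod]
          simp only [abs_pow]
      _ ≤ ∏ k, |x k| ^ y k :=
          mul_le_of_le_one_left (Finset.prod_nonneg fun k _ => by positivity) hM1
  linarith

/-- For positive `t` there is a positive point `x` with `x^{α j} = t j / t 0`. -/
lemma exists_pos_monomial_values (hα0 : α 0 = 0) (hB : ∀ j, B j = realPoint (α j))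
    {t : Fin (n + 1) → ℝ} (ht : ∀ j, 0 < t j) :
    ∃ x : Fin n → ℝ, (∀ k, 0 < x k) ∧ ∀ u : Fin n →₀ ℕ,
      ∏ k, x k ^ u k = (∏ j, t j ^ B.coord j (realPoint u)) / t 0 := by
  have hlog (u : Fin n →₀ ℕ) : ∏ j, t j ^ B.coord j (realPoint u) =
      Real.exp (∑ j, B.coord j (realPoint u) * Real.log (t j)) := by
    rw [Real.exp_sum]
    exact Finset.prod_congr rfl fun j _ => by rw [Real.rpow_def_of_pos (ht j), mul_comm]
  -- `A` is the affine function with value `log t_j` at `α j`. Its linear part supplies `log x_k`;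
  -- its constant term is `log t_0` because `α 0 = 0`.
  set A : (Fin n → ℝ) →ᵃ[ℝ] ℝ := ∑ j, Real.log (t j) • B.coord j with hA
  have hAapp (p : Fin n → ℝ) : A p = ∑ j, B.coord j p * Real.log (t j) := by
    have (s : Finset (Fin (n + 1))) : (∑ j ∈ s, Real.log (t j) • B.coord j) p =
        ∑ j ∈ s, B.coord j p * Real.log (t j) := by
      induction s using Finset.induction_on with
      | empty => simp
      | insert i s hi ih =>
        rw [Finset.sum_insert hi, Finset.sum_insert hi, ← ih, AffineMap.coe_add, Pi.add_apply,
          AffineMap.coe_smul, Pi.smul_apply, smul_eq_mul, mul_comm]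
    exact this _
  have hzero : realPoint (α 0) = 0 := by rw [hα0]; ext k; simp [realPoint]
  have hA0 : A 0 = Real.log (t 0) := by
    rw [hAapp, ← hzero, ← hB, Finset.sum_eq_single 0]
    · simp
    · intro j _ hj; rw [B.coord_apply_ne hj, zero_mul]
    · simp
  refine ⟨fun k => Real.exp (A.linear (Pi.single k 1)), fun k => Real.exp_pos _, fun u => ?_⟩
  have hlin : A (realPoint u) = ∑ k, (u k : ℝ) * A.linear (Pi.single k 1) + A 0 := by
    have h1 := congrFun A.decomp (realPoint u)
    have h2 : A.linear (realPoint u) = ∑ k, (u k : ℝ) * A.linear (Pi.single k 1) := by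
      conv_lhs => rw [pi_eq_sum_univ' (realPoint u)]
      simp [realPoint]
    rw [h1, Pi.add_apply, h2]
  rw [hlog, ← hAapp, hlin, hA0, Real.exp_add, Real.exp_log (ht 0),
    mul_div_cancel_right₀ _ (ht 0).ne', Real.exp_sum]
  exact Finset.prod_congr rfl fun k _ => by rw [← Real.exp_nat_mul]

end Simplex

/-! ### Lagrange conditions and the circuit decomposition. -/

/-- The maximum of a sum of weighted geometric means on a simplex is attained at a point with
positive entries, where the Lagrange conditions hold. -/
lemma exists_stationary_point {ι κ : Type*} [Fintype ι] [Nonempty ι] {I : Finset κ}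
    (hI : I.Nonempty) {b : ι → ℝ} (hb : ∀ j, 0 < b j) {a : κ → ℝ} (ha : ∀ y ∈ I, 0 < a y)
    {w : κ → ι → ℝ} (hw : ∀ y ∈ I, ∀ j, 0 < w y j) (hw1 : ∀ y ∈ I, ∑ j, w y j = 1) :
    ∃ (t : ι → ℝ) (M : ℝ), (∀ j, 0 < t j) ∧ 0 < M ∧
      ∀ j, ∑ y ∈ I, a y * w y j * ∏ i, t i ^ w y i = M * (b j * t j) := by
  classical
  set G : (ι → ℝ) → ℝ := fun t => ∑ y ∈ I, a y * ∏ i, t i ^ w y i with hG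
  have hGcont : ContinuousOn G Set.univ := by
    refine continuousOn_finsetSum _ fun y hy => continuousOn_const.mul ?_
    refine continuousOn_finsetProd _ fun i _ => ?_
    exact ((continuous_apply i).rpow_const fun _ => Or.inr (hw y hy i).le).continuousOn
  have hGpos (t : ι → ℝ) (ht : ∀ j, 0 < t j) : 0 < G t :=
    Finset.sum_pos (fun y hy => mul_pos (ha y hy)
      (Finset.prod_pos fun i _ => Real.rpow_pos_of_pos (ht i) _)) hI
  have hGhom (c : ℝ) (hc : 0 < c) (t : ι → ℝ) (ht : ∀ j, 0 < t j) :
      G (fun j => c * t j) = c * G t := by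
    simp only [hG, Finset.mul_sum]
    refine Finset.sum_congr rfl fun y hy => ?_
    have : ∏ i, (c * t i) ^ w y i = c * ∏ i, t i ^ w y i := by
      simp only [fun i => Real.mul_rpow hc.le (ht i).le (z := w y i), Finset.prod_mul_distrib]
      rw [← Real.rpow_sum_of_pos hc, hw1 y hy, Real.rpow_one]
    rw [this]
    ring
  set S : Set (ι → ℝ) := {t | (∀ j, 0 ≤ t j) ∧ ∑ j, b j * t j = 1} with hS
  have hSclosed : IsClosed S := by
    have h1 : IsClosed {t : ι → ℝ | ∀ j, 0 ≤ t j} := by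
      simp only [Set.ofPred_forall]
      exact isClosed_iInter fun j => isClosed_le continuous_const (continuous_apply j)
    exact h1.inter (isClosed_eq (by fun_prop) continuous_const)
  have hScomp : IsCompact S := by
    refine (isCompact_Icc (a := (0 : ι → ℝ)) (b := fun j => (b j)⁻¹)).of_isClosed_subset hSclosed
      fun t ht => ⟨ht.1, fun j => ?_⟩
    change t j ≤ (b j)⁻¹
    rw [← one_div, le_div_iff₀ (hb j), mul_comm, ← ht.2]
    exact Finset.single_le_sum (f := fun i => b i * t i)
      (fun i _ => mul_nonneg (hb i).le (ht.1 i)) (Finset.mem_univ j)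
  have hnorm (t : ι → ℝ) (ht : ∀ j, 0 < t j) : 0 < ∑ j, b j * t j :=
    Finset.sum_pos (fun j _ => mul_pos (hb j) (ht j)) Finset.univ_nonempty
  have hmemS (t : ι → ℝ) (ht : ∀ j, 0 < t j) :
      (fun j => (∑ j, b j * t j)⁻¹ * t j) ∈ S := by
    refine ⟨fun j => mul_nonneg (inv_nonneg.2 (hnorm t ht).le) (ht j).le, ?_⟩
    rw [← inv_mul_cancel₀ (hnorm t ht).ne', Finset.mul_sum]
    exact Finset.sum_congr rfl fun j _ => by ring
  have hone : ∀ j : ι, (0 : ℝ) < (fun _ => 1 : ι → ℝ) j := fun _ => one_pos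
  obtain ⟨t, htS, htmax⟩ := hScomp.exists_isMaxOn ⟨_, hmemS _ hone⟩
    (hGcont.mono (Set.subset_univ S))
  -- Homogeneity of degree one turns the constrained maximum into an inequality on the whole open
  -- orthant.
  have hbound (s : ι → ℝ) (hs : ∀ j, 0 < s j) : G s ≤ G t * ∑ j, b j * s j := by
    have h := htmax (hmemS s hs)
    simp only [Set.mem_ofPred_eq] at h
    rw [hGhom _ (inv_pos.2 (hnorm s hs)) s hs, inv_mul_le_iff₀ (hnorm s hs)] at h
    linarith
  have hM : 0 < G t := by
    have h1 := hGpos _ hone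
    have h2 := hnorm _ hone
    have h3 := hbound _ hone
    exact pos_of_mul_pos_left (h1.trans_le h3) h2.le
  -- All exponents are positive, so `G` vanishes as soon as one coordinate does.
  have ht (j : ι) : 0 < t j := by
    refine (htS.1 j).lt_of_ne fun h => hM.ne' ?_
    refine Finset.sum_eq_zero fun y hy => ?_
    rw [Finset.prod_eq_zero (Finset.mem_univ j), mul_zero]
    rw [← h, Real.zero_rpow (hw y hy j).ne']
  refine ⟨t, G t, ht, hM, fun j => ?_⟩
  -- Multiplying only `t j` by `exp s` in `hbound` gives `h s ≤ 0 = h 0`; the Lagrange condition is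
  -- `h' 0 = 0`.
  set h : ℝ → ℝ := fun s => ∑ y ∈ I, a y * (∏ i, t i ^ w y i) * Real.exp (s * w y j) -
    G t * (1 + b j * t j * (Real.exp s - 1)) with hh
  have hmax : IsLocalMax h 0 := by
    refine Filter.Eventually.of_forall fun s => ?_
    have h0 : h 0 = 0 := by simp [hh, hG]
    rw [h0, hh]
    have hs (i : ι) : 0 < t i * (if i = j then Real.exp s else 1) :=
      mul_pos (ht i) (by split_ifs <;> positivity)
    have h1 := hbound _ hs
    have h2 : G (fun i => t i * (if i = j then Real.exp s else 1)) =
        ∑ y ∈ I, a y * (∏ i, t i ^ w y i) * Real.exp (s * w y j) := by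
      refine Finset.sum_congr rfl fun y hy => ?_
      have (i : ι) : (t i * (if i = j then Real.exp s else 1)) ^ w y i =
          t i ^ w y i * (if i = j then Real.exp (s * w y i) else 1) := by
        rw [Real.mul_rpow (ht i).le (by split_ifs <;> positivity)]
        split_ifs
        · rw [Real.exp_mul]
        · rw [Real.one_rpow]
      simp only [this, Finset.prod_mul_distrib]
      simp [mul_assoc]
    have h3 : ∑ i, b i * (t i * (if i = j then Real.exp s else 1)) =
        1 + b j * t j * (Real.exp s - 1) := by
      have h4 := htS.2
      rw [← Finset.add_sum_erase _ _ (Finset.mem_univ j)] at h4 ⊢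
      have : ∑ i ∈ Finset.univ.erase j, b i * (t i * (if i = j then Real.exp s else 1)) =
          ∑ i ∈ Finset.univ.erase j, b i * t i :=
        Finset.sum_congr rfl fun i hi => by rw [if_neg (Finset.ne_of_mem_erase hi), mul_one]
      rw [this, if_pos rfl]
      linear_combination h4
    rw [h2, h3] at h1
    linarith
  have hder : HasDerivAt h (∑ y ∈ I, a y * (∏ i, t i ^ w y i) * (w y j) -
      G t * (b j * t j)) 0 := by
    refine HasDerivAt.sub (HasDerivAt.fun_sum fun y _ => HasDerivAt.const_mul _ ?_)
      (HasDerivAt.const_mul _ ?_)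
    · have := ((hasDerivAt_id (0 : ℝ)).mul_const (w y j)).exp
      simpa using this
    · have := (((Real.hasDerivAt_exp 0).sub_const 1).const_mul (b j * t j)).const_add 1
      simpa using this
  have := hmax.hasDerivAt_eq_zero hder
  rw [sub_eq_zero] at this
  rw [← this]
  exact Finset.sum_congr rfl fun y _ => by ring

/-- A nonnegative polynomial of the simplex is a sum of rescaled normalized circuit
polynomials. -/
lemma exists_circuit_decomposition {n : ℕ} {α : Fin (n + 1) → (Fin n →₀ ℕ)}
    {B : AffineBasis (Fin (n + 1)) ℝ (Fin n → ℝ)} (hα0 : α 0 = 0)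
    (hB : ∀ j, B j = realPoint (α j)) {I : Finset (Fin n →₀ ℕ)} (hI : I.Nonempty)
    (hIint : ∀ y ∈ I, realPoint y ∈ interior (latticeHull (Set.range α)))
    {b : Fin (n + 1) → ℝ} (hb : ∀ j, 0 < b j)
    {a : (Fin n →₀ ℕ) → ℝ} (ha : ∀ y ∈ I, 0 < a y)
    (hf : ∀ x : Fin n → ℝ,
      0 ≤ eval x (∑ j, monomial (α j) (b j) - ∑ y ∈ I, monomial y (a y))) :
    ∃ (c : (Fin n →₀ ℕ) → ℝ) (z : Fin n → ℝ) (M : ℝ) (β : (Fin n →₀ ℕ) → Fin (n + 1) → ℝ),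
      (∀ y ∈ I, 0 < c y) ∧ (∀ k, z k ≠ 0) ∧ 0 < M ∧ M ≤ 1 ∧
      (∀ y ∈ I, ∀ j, 0 < β y j) ∧ (∀ j, ∑ y ∈ I, β y j = b j) ∧
      ∀ y ∈ I, ∑ j, monomial (α j) (β y j) + monomial y (-a y) =
        c y • scaleVars z (∑ j, monomial (α j) (B.coord j (realPoint y)) - monomial y M) := by
  have hw := fun y hy j => coord_pos_of_mem_interior hB (hIint y hy) j
  obtain ⟨t, M, ht, hM, hstat⟩ := exists_stationary_point hI hb ha hw
    fun y _ => B.sum_coord_apply_eq_one (realPoint y)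
  obtain ⟨x, hx, hxt⟩ := exists_pos_monomial_values hα0 hB ht
  set g : (Fin n →₀ ℕ) → ℝ := fun y => ∏ j, t j ^ B.coord j (realPoint y) with hg
  have hgpos (y : Fin n →₀ ℕ) : 0 < g y :=
    Finset.prod_pos fun j _ => Real.rpow_pos_of_pos (ht j) _
  have hgα (j : Fin (n + 1)) : g (α j) = t j := by
    simp only [hg]
    rw [Finset.prod_eq_single j]
    · rw [← hB, B.coord_apply_eq, Real.rpow_one]
    · intro i _ hi
      rw [← hB, B.coord_apply_ne hi, Real.rpow_zero]
    · simp
  -- Summing the Lagrange conditions over `j` gives `f(x) = (1 - M) (∑ b_j t_j) / t_0`.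
  have hM1 : M ≤ 1 := by
    have h := hf x
    have heval (u : Fin n →₀ ℕ) (s : ℝ) : eval x (monomial u s) = s * (g u / t 0) := by
      rw [eval_monomial, Finsupp.prod_fintype _ _ (by simp), hxt]
    simp only [map_sub, map_sum, heval, hgα] at h
    have h1 : ∑ y ∈ I, a y * g y = M * ∑ j, b j * t j := by
      rw [Finset.mul_sum, ← Finset.sum_congr rfl fun j _ => hstat j, Finset.sum_comm]
      refine Finset.sum_congr rfl fun y _ => ?_
      rw [← Finset.sum_mul, ← Finset.mul_sum, B.sum_coord_apply_eq_one, mul_one]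
    simp only [← mul_div_assoc, ← Finset.sum_div] at h
    rw [h1, ← sub_div, le_div_iff₀ (ht 0), zero_mul] at h
    have h2 : 0 < ∑ j, b j * t j :=
      Finset.sum_pos (fun j _ => mul_pos (hb j) (ht j)) Finset.univ_nonempty
    nlinarith
  have hz (u : Fin n →₀ ℕ) : ∏ k, (x k)⁻¹ ^ u k = t 0 / g u := by
    simp only [inv_pow]
    rw [Finset.prod_inv_distrib, hxt, inv_div]
  -- The rescaling moves `x` to the all-ones point. There the terms of the normalized circuit are
  -- `λ_j(y)` and `-M`; matching the last with `-a_y x^y` determines the factor and then `β`.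
  refine ⟨fun y => a y * g y / (M * t 0), fun k => (x k)⁻¹, M,
    fun y j => a y * B.coord j (realPoint y) * g y / (M * t j),
    fun y hy => div_pos (mul_pos (ha y hy) (hgpos y)) (mul_pos hM (ht 0)),
    fun k => inv_ne_zero (hx k).ne', hM, hM1,
    fun y hy j => div_pos (mul_pos (mul_pos (ha y hy) (hw y hy j)) (hgpos y))
      (mul_pos hM (ht j)), fun j => ?_, fun y _ => ?_⟩
  · have := (ht j).ne'
    rw [← Finset.sum_div, hstat j]
    field_simp
  · simp only [map_sub, map_sum, scaleVars_monomial, hz, hgα, smul_sub, Finset.smul_sum,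
      smul_monomial, smul_eq_mul]
    rw [sub_eq_add_neg, ← map_neg]
    have := (ht 0).ne'
    have := (hgpos y).ne'
    congr 1
    · refine Finset.sum_congr rfl fun j _ => ?_
      have := (ht j).ne'
      congr 1
      field_simp
    · congr 1
      field_simp

/-! ### Degree bounds for the summands, and the theorem. -/

/-- No vertex term cancels, since the vertices are distinct and lie outside `I`. -/
lemma degree_vertex_le {n m : ℕ} {α : Fin (n + 1) → (Fin n →₀ ℕ)} {I : Finset (Fin n →₀ ℕ)}
    (hinj : Function.Injective α) (hne : ∀ y ∈ I, ∀ j, y ≠ α j) {b : Fin (n + 1) → ℝ}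
    (hb : ∀ j, b j ≠ 0) {a : (Fin n →₀ ℕ) → ℝ}
    (hd : (∑ j, monomial (α j) (b j) - ∑ y ∈ I, monomial y (a y)).totalDegree ≤ m)
    (j : Fin (n + 1)) : ∑ k, α j k ≤ m := by
  have h : coeff (α j) (∑ j, monomial (α j) (b j) - ∑ y ∈ I, monomial y (a y)) = b j := by
    rw [coeff_sub, coeff_sum, coeff_sum]
    simp only [coeff_monomial]
    rw [Finset.sum_eq_single j (fun i _ hi => if_neg fun h => hi (hinj h)) (by simp),
      Finset.sum_eq_zero fun y hy => if_neg (hne y hy j)]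
    simp
  have h1 := le_totalDegree (mem_support_iff.2 (h.symm ▸ hb j))
  rw [Finsupp.sum_fintype _ _ (fun _ => rfl)] at h1
  exact h1.trans hd

lemma totalDegree_circuit_le {n m : ℕ} {α : Fin (n + 1) → (Fin n →₀ ℕ)}
    {B : AffineBasis (Fin (n + 1)) ℝ (Fin n → ℝ)} (hB : ∀ j, B j = realPoint (α j))
    {y : Fin n →₀ ℕ} (hy : realPoint y ∈ interior (latticeHull (Set.range α)))
    (hα : ∀ j, ∑ k, α j k ≤ m) (β : Fin (n + 1) → ℝ) (c : ℝ) :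
    (∑ j, monomial (α j) (β j) + monomial y c).totalDegree ≤ m := by
  have hmon (u : Fin n →₀ ℕ) (s : ℝ) (hu : ∑ k, u k ≤ m) : (monomial u s).totalDegree ≤ m := by
    refine (totalDegree_monomial_le u s).trans ?_
    rwa [Finsupp.sum_fintype _ _ (fun _ => rfl)]
  -- The degree of `y` is a weighted mean of the degrees of the vertices.
  have hym : ∑ k, y k ≤ m := by
    have h : ((∑ k, y k : ℕ) : ℝ) ≤ m := by
      push_cast
      calc ∑ k, (y k : ℝ) = ∑ j, B.coord j (realPoint y) * ((∑ k, α j k : ℕ) : ℝ) := by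
            simp only [← sum_coord_mul hB y]
            rw [Finset.sum_comm]
            push_cast
            simp only [Finset.mul_sum]
        _ ≤ ∑ j, B.coord j (realPoint y) * (m : ℝ) :=
            Finset.sum_le_sum fun j _ => mul_le_mul_of_nonneg_left (by exact_mod_cast hα j)
              (coord_pos_of_mem_interior hB hy j).le
        _ = m := by rw [← Finset.sum_mul, B.sum_coord_apply_eq_one, one_mul]
    exact_mod_cast h
  refine (totalDegree_add _ _).trans (max_le ?_ (hmon _ _ hym))
  exact totalDegree_finsetSum_le fun j _ => hmon _ _ (hα j)

theorem mainTheorem4 (n d : ℕ) (hn : 0 < n)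
    (α : Fin (n + 1) → (Fin n →₀ ℕ)) (hα0 : α 0 = 0)
    (hαeven : ∀ j, IsEvenPoint (α j))
    (hαsimplex : AffineIndependent ℝ (fun j => realPoint (α j)))
    (I : Finset (Fin n →₀ ℕ)) (hI : I.Nonempty)
    (hIint : ∀ y ∈ I, realPoint y ∈ interior (latticeHull (Set.range α)))
    (b : Fin (n + 1) → ℝ) (hb : ∀ j, 0 < b j)
    (a : (Fin n →₀ ℕ) → ℝ) (ha : ∀ y ∈ I, 0 < a y)
    (f : MvPolynomial (Fin n) ℝ)
    (hf : f = ∑ j, MvPolynomial.monomial (α j) (b j)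
      - ∑ y ∈ I, MvPolynomial.monomial y (a y))
    (hd : f.totalDegree ≤ 2 * d) :
    (f ∈ nonnegCone n (2 * d) ↔
      ∃ E : (Fin n →₀ ℕ) → MvPolynomial (Fin n) ℝ,
        (∀ y ∈ I, E y ∈ circuitPolynomials α y ∧ E y ∈ nonnegCone n (2 * d)) ∧
          f = ∑ y ∈ I, E y) ∧
    ((↑I : Set (Fin n →₀ ℕ)) ⊆ maximalMediatedSet (Set.range α) →
      (f ∈ nonnegCone n (2 * d) ↔ f ∈ sosCone n d) ∧
      (f ∈ sosCone n d ↔ IsSumOfBinomialSquares f)) ∧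
    (IsHSimplex (Set.range α) →
      (f ∈ nonnegCone n (2 * d) ↔ f ∈ sosCone n d) ∧
      (f ∈ sosCone n d ↔ IsSumOfBinomialSquares f)) := by
  obtain ⟨B, hB⟩ := exists_affineBasis_of_affineIndependent hαsimplex
  have hdecomp (β : (Fin n →₀ ℕ) → Fin (n + 1) → ℝ) (hβ : ∀ j, ∑ y ∈ I, β y j = b j) :
      f = ∑ y ∈ I, (∑ j, monomial (α j) (β y j) + monomial y (-a y)) := by
    rw [hf, Finset.sum_add_distrib, Finset.sum_comm, sub_eq_add_neg, ← Finset.sum_neg_distrib]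
    simp only [← map_sum, hβ, map_neg]
  have hmediated (hImed : (↑I : Set (Fin n →₀ ℕ)) ⊆ maximalMediatedSet (Set.range α)) :
      (f ∈ nonnegCone n (2 * d) ↔ f ∈ sosCone n d) ∧
      (f ∈ sosCone n d ↔ IsSumOfBinomialSquares f) := by
    have hbin (h : f ∈ nonnegCone n (2 * d)) : IsSumOfBinomialSquares f := by
      obtain ⟨c, z, M, β, hc, hz, hM0, hM1, -, hβb, hE⟩ :=
        exists_circuit_decomposition hα0 hB hI hIint hb ha (hf ▸ h.2)
      rw [hdecomp β hβb]
      refine .sum fun y hy => ?_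
      rw [hE y hy]
      exact ((isSumOfBinomialSquares_circuit hn hB hαeven (hIint y hy) (hImed hy) hM0.le
        hM1).scaleVars hz).smul (hc y hy).le
    exact ⟨⟨fun h => (hbin h).mem_sosCone hd, fun h => h.1⟩,
      ⟨fun h => hbin h.1, fun h => h.mem_sosCone hd⟩⟩
  refine ⟨⟨fun h => ?_, ?_⟩, hmediated, fun hH => hmediated fun y hy => ?_⟩
  · obtain ⟨c, z, M, β, hc, hz, hM0, hM1, hβ, hβb, hE⟩ :=
      exists_circuit_decomposition hα0 hB hI hIint hb ha (hf ▸ h.2)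
    refine ⟨_, fun y hy => ⟨⟨hαsimplex, hIint y hy, β y, -a y, hβ y hy,
      neg_ne_zero.2 (ha y hy).ne', rfl⟩, ?_, fun x => ?_⟩, hdecomp β hβb⟩
    · exact totalDegree_circuit_le hB (hIint y hy) (degree_vertex_le (vertices_injective hB)
        (fun y hy => ne_vertex_of_mem_interior hn hB (hIint y hy)) (fun j => (hb j).ne')
        (hf ▸ hd)) _ _
    · rw [hE y hy, smul_eval, eval_scaleVars]
      exact mul_nonneg (hc y hy).le (eval_circuit_nonneg hB hαeven (hIint y hy) hM0.le hM1 _)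
  · rintro ⟨E, hE, hfE⟩
    refine ⟨hd, fun x => ?_⟩
    rw [hfE, map_sum]
    exact Finset.sum_nonneg fun y hy => (hE y hy).2.2 x
  · rw [hH]
    exact Set.mem_ofPred_eq.symm ▸ interior_subset (s := latticeHull (Set.range α)) (hIint y hy)
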